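/- Let $G$ be a finite Abelian group and let $A\subseteq G$ be a nonempty set with $|A|\le 5$. Suppose that $A$ is spectral, i.e. there is a set $\Lambda$ of characters of $G$ whose restrictions to $A$ form an orthogonal basis of $L^2(A)$, where $A$ carries the counting measure. Then $A$ tiles $G$ by translation, i.e. there is a set $T\subseteq G$ such that $\sum_{t\in T}\chi_A(x-t)=1$ for every $x\in G$, where $\chi_A$ is the indicator function of $A$. -/

import Mathlib

/-- The restriction to `A` of a character `χ` of a finite abelian group, as a vector of `L²(A)`
(with counting measure). On a finite group every `AddChar G ℂ` is automatically unimodular. -/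
noncomputable def charRestrict {G : Type*} [AddCommGroup G] (A : Finset G) (χ : AddChar G ℂ) :
    EuclideanSpace ℂ A :=
  WithLp.toLp 2 fun a : A => χ (a : G)

/-- `Λ` is a spectrum of the subset `A` of a finite abelian group: the restrictions to `A` of the
characters in `Λ` form an orthogonal basis of `L²(A)`. -/
structure IsSpectrum {G : Type*} [AddCommGroup G] (A : Finset G) (Λ : Set (AddChar G ℂ)) :
    Prop where
  linearIndepOn : LinearIndepOn ℂ (charRestrict A) Λ
  orthogonal : Λ.Pairwise fun χ ψ => inner ℂ (charRestrict A χ) (charRestrict A ψ) = 0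
  span_eq_top : Submodule.span ℂ (charRestrict A '' Λ) = ⊤

/-- `A` is spectral: it has a spectrum. -/
def IsSpectral {G : Type*} [AddCommGroup G] (A : Finset G) : Prop :=
  ∃ Λ : Set (AddChar G ℂ), IsSpectrum A Λ

/-- `A` tiles the finite abelian group `G` by translation: for some set `T` of translates,
`∑_{t ∈ T} χ_A (x - t) = 1` for every `x`, where `χ_A` is the indicator function of `A`. -/
def TilesGroup {G : Type*} [AddCommGroup G] (A : Finset G) : Prop :=
  ∃ T : Finset G, ∀ x : G, ∑ t ∈ T, (A : Set G).indicator (fun _ => (1 : ℕ)) (x - t) = 1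

/-!
Let `n = |A|`. A spectrum of `A` is a set of `n` characters whose pairwise quotients `ψ` satisfy
`∑ a ∈ A, ψ a = 0`; equivalently, their values on `A` form an `n × n` complex Hadamard matrix whose
entries are roots of unity. The tiling is read off from one or two of these quotients.

If some `ψ` maps `A` bijectively onto a coset of the `n`-th roots of unity, then the preimage under
`ψ` of a transversal of these roots of unity is a set of translates
(`tilesGroup_of_injOn_of_pow_eq`). The trivial character does for `n = 1`, and for `n = 2` and
`n = 3` every quotient is of this kind, since two or three unimodular numbers with sum zero are
equally spaced on the unit circle.

For `n = 4`, four unimodular numbers with sum zero split into two pairs `z, -z`. Comparing how three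
quotients by a common character split, one finds quotients `φ`, `ψ` such that `φ` is constant on
both halves of a partition of `A` into two pairs, with opposite values, and `ψ` changes sign inside
each pair; this pattern tiles (`tilesGroup_of_eq_four`).

For `n = 5`, Galois conjugation shows that five roots of unity with sum zero either are the rotated
fifth roots of unity or contain a cancelling pair `α, -α` (`pow_five_eq_of_sum_eq_zero`). In the
second case the other three are `β, β * ω, β * ω ^ 2`. If every quotient had a cancelling pair, one
could separate the 2-power part of all entries, which only sees the signs, from the odd part, which
only sees the cube roots of unity. The signs force the cancelling pairs of any three characters to
form a triangle in `A`, the odd part is constant on that triangle, and four characters then need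
three distinct primitive cube roots of unity (`IsTwoThree.false_of_four_rows`). So some quotient
falls under the first tiling criterion.
-/

/-! ### Tiling criteria, and the characters of a spectrum -/

theorem tilesGroup_of_existsUnique {G : Type*} [AddCommGroup G] [Finite G] {A : Finset G}
    (T : Set G) (h : ∀ x, ∃! a, a ∈ A ∧ x - a ∈ T) : TilesGroup A := by
  classical
  refine ⟨(Set.toFinite T).toFinset, fun x => ?_⟩
  obtain ⟨a, ⟨haA, haT⟩, huniq⟩ := h x
  rw [Finset.sum_eq_single (x - a)]
  · simp [haA]
  · intro t ht hne
    refine Set.indicator_of_notMem (fun hmem => hne ?_) _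
    have := huniq (x - t) ⟨by simpa using hmem, by simpa using ht⟩
    rw [← this]; abel
  · intro hn
    exact absurd (by simpa using haT) hn

/-- A character that maps `A` bijectively onto a coset of the `|A|`-th roots of unity yields a
tiling: the translates are the preimage of a transversal of these roots of unity. -/
theorem tilesGroup_of_injOn_of_pow_eq {G : Type*} [AddCommGroup G] [Finite G] {A : Finset G}
    (hne : A.Nonempty) (ψ : AddChar G ℂ) (hinj : Set.InjOn ψ A)
    (hpow : ∀ a ∈ A, ∀ b ∈ A, ψ a ^ A.card = ψ b ^ A.card) : TilesGroup A := by
  classical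
  obtain ⟨a₀, ha₀⟩ := hne
  have : NeZero A.card := ⟨Finset.card_ne_zero.2 ⟨a₀, ha₀⟩⟩
  have hψ : ∀ x, ψ x ≠ 0 := fun x => (ψ.val_isUnit x).ne_zero
  -- the ratios `ψ a / ψ a₀` exhaust the roots of unity of order `A.card`
  have himg : A.image (fun a => ψ a / ψ a₀) = Polynomial.nthRootsFinset A.card (1 : ℂ) := by
    refine Finset.eq_of_subset_of_card_le ?_ ?_
    · intro z hz
      obtain ⟨a, ha, rfl⟩ := Finset.mem_image.1 hz
      rw [Polynomial.mem_nthRootsFinset (NeZero.pos _), div_pow, hpow a ha a₀ ha₀,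
        div_self (pow_ne_zero _ (hψ _))]
    · rw [(Complex.isPrimitiveRoot_exp _ (NeZero.ne A.card)).card_nthRootsFinset,
        Finset.card_image_of_injOn]
      intro a ha b hb hab
      exact hinj ha hb ((div_left_inj' (hψ _)).1 hab)
  -- a choice of one representative in every fibre of `z ↦ z ^ A.card`
  choose r hr using fun z : ℂ => IsAlgClosed.exists_pow_nat_eq z (NeZero.pos A.card)
  refine tilesGroup_of_existsUnique {x | ψ x = r (ψ x ^ A.card)} fun x => ?_
  set w := r (ψ (x - a₀) ^ A.card) with hw
  have hwpow : w ^ A.card = ψ (x - a₀) ^ A.card := hr _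
  have hw0 : w ≠ 0 := fun h => by
    rw [h, zero_pow (NeZero.ne _)] at hwpow
    exact pow_ne_zero _ (hψ _) hwpow.symm
  have hT : ∀ a ∈ A, (ψ (x - a) = r (ψ (x - a) ^ A.card) ↔ ψ a = ψ x / w) := by
    intro a ha
    have h1 : ψ (x - a) ^ A.card = ψ (x - a₀) ^ A.card := by
      rw [AddChar.map_sub_eq_div, AddChar.map_sub_eq_div, div_pow, div_pow, hpow a ha a₀ ha₀]
    rw [h1, ← hw, AddChar.map_sub_eq_div, div_eq_iff (hψ _), eq_div_iff hw0, eq_comm, mul_comm]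
  have hmem : ψ x / w / ψ a₀ ∈ A.image (fun a => ψ a / ψ a₀) := by
    rw [himg, Polynomial.mem_nthRootsFinset (NeZero.pos _), div_pow, div_pow, hwpow,
      AddChar.map_sub_eq_div, div_pow]
    have := pow_ne_zero A.card (hψ x)
    have := pow_ne_zero A.card (hψ a₀)
    field_simp
  obtain ⟨a, ha, hae⟩ := Finset.mem_image.1 hmem
  have hae' : ψ a = ψ x / w := (div_left_inj' (hψ _)).1 hae
  refine ⟨a, ⟨ha, (hT a ha).2 hae'⟩, fun b hb => ?_⟩
  exact hinj hb.1 ha (((hT b hb.1).1 hb.2).trans hae'.symm)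

/-- The half-open upper half plane: the open upper half plane with the positive real axis. It is
used only because it contains exactly one of `z` and `-z` for every `z ≠ 0`. -/
def halfPlane : Set ℂ := {z | 0 < z.im ∨ z.im = 0 ∧ 0 < z.re}

theorem neg_mem_halfPlane {z : ℂ} (hz : z ≠ 0) : -z ∈ halfPlane ↔ z ∉ halfPlane := by
  have : ¬ (z.re = 0 ∧ z.im = 0) := fun h => hz (Complex.ext h.1 h.2)
  simp only [halfPlane, Set.mem_ofPred_eq, Complex.neg_im, Complex.neg_re]
  grind

/-- The translates are the `x` for which both `φ x` and `ψ x` lie in the half plane: `φ` decides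
between `{a, b}` and `{c, d}`, and `ψ` then decides inside the pair. -/
theorem tilesGroup_of_eq_four {G : Type*} [AddCommGroup G] [Finite G] {A : Finset G}
    {a b c d : G} (hA : ∀ x, x ∈ A ↔ x = a ∨ x = b ∨ x = c ∨ x = d) (φ ψ : AddChar G ℂ)
    (hab : φ a = φ b) (hac : φ a = -φ c) (hcd : φ c = φ d)
    (hab' : ψ a = -ψ b) (hcd' : ψ c = -ψ d) : TilesGroup A := by
  refine tilesGroup_of_existsUnique {x | φ x ∈ halfPlane ∧ ψ x ∈ halfPlane} fun x => ?_
  have hφ : ∀ x, φ x ≠ 0 := fun x => (φ.val_isUnit x).ne_zero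
  have hψ : ∀ x, ψ x ≠ 0 := fun x => (ψ.val_isUnit x).ne_zero
  have e1 : φ (x - b) = φ (x - a) := by simp only [AddChar.map_sub_eq_div, hab]
  have e2 : φ (x - c) = -φ (x - a) := by simp only [AddChar.map_sub_eq_div, hac, div_neg, neg_neg]
  have e3 : φ (x - d) = -φ (x - a) := by
    simp only [AddChar.map_sub_eq_div, hac, hcd, div_neg, neg_neg]
  have e4 : ψ (x - b) = -ψ (x - a) := by
    simp only [AddChar.map_sub_eq_div, hab', div_neg, neg_neg]
  have e5 : ψ (x - d) = -ψ (x - c) := by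
    simp only [AddChar.map_sub_eq_div, hcd', div_neg, neg_neg]
  have n1 := neg_mem_halfPlane (hφ (x - a))
  have n2 := neg_mem_halfPlane (hψ (x - a))
  have n3 := neg_mem_halfPlane (hψ (x - c))
  rw [← e2] at n1
  rw [← e4] at n2
  rw [← e5] at n3
  rw [← e2] at e3
  simp only [hA, Set.mem_ofPred_eq]
  by_cases h1 : φ (x - a) ∈ halfPlane
  · by_cases h2 : ψ (x - a) ∈ halfPlane
    · exact ⟨a, by grind, by rintro y ⟨rfl | rfl | rfl | rfl, hy⟩ <;> grind⟩
    · exact ⟨b, by grind, by rintro y ⟨rfl | rfl | rfl | rfl, hy⟩ <;> grind⟩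
  · by_cases h2 : ψ (x - c) ∈ halfPlane
    · exact ⟨c, by grind, by rintro y ⟨rfl | rfl | rfl | rfl, hy⟩ <;> grind⟩
    · exact ⟨d, by grind, by rintro y ⟨rfl | rfl | rfl | rfl, hy⟩ <;> grind⟩

/-- A spectrum has as many elements as `A`, and orthogonality of two of its characters says that
their quotient sums to zero over `A`. -/
theorem IsSpectral.exists_characters {G : Type*} [AddCommGroup G] [Finite G] {A : Finset G}
    (hA : IsSpectral A) : ∃ χ : Fin A.card → AddChar G ℂ,
      ∀ i j, i ≠ j → ∑ a ∈ A, (χ j / χ i) a = 0 := by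
  obtain ⟨Λ, hli, horth, hspan⟩ := hA
  let b := Module.Basis.mk (v := fun χ : Λ => charRestrict A (χ : AddChar G ℂ)) hli
    (by rw [← Set.image_eq_range, hspan])
  have hfin : Finite Λ := Module.Finite.finite_basis b
  have hcard : Nat.card Λ = A.card := by
    rw [← Module.finrank_eq_nat_card_basis b, finrank_euclideanSpace, Fintype.card_coe]
  let e := Finite.equivFinOfCardEq hcard
  refine ⟨fun i => (e.symm i : AddChar G ℂ), fun i j hij => ?_⟩
  have h := horth (e.symm i).2 (e.symm j).2
    (fun h => hij (e.symm.injective (Subtype.ext h)))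
  rw [← Finset.sum_coe_sort A]
  simp only [charRestrict, PiLp.inner_apply, RCLike.inner_apply] at h
  rw [← h]
  refine Finset.sum_congr rfl fun a _ => ?_
  rw [AddChar.div_apply', div_eq_mul_inv, ← AddChar.inv_apply_eq_conj]

/-! ### Vanishing sums of roots of unity -/

theorem mul_eq_sq_and_ne_of_add_eq_zero {x y z : ℂ} (hx : ‖x‖ = 1) (hy : ‖y‖ = 1)
    (hz : ‖z‖ = 1) (h : x + y + z = 0) : x * y = z ^ 2 ∧ x ≠ y := by
  have hx0 : x ≠ 0 := norm_ne_zero_iff.1 (by simp [hx])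
  have hy0 : y ≠ 0 := norm_ne_zero_iff.1 (by simp [hy])
  have hz0 : z ≠ 0 := norm_ne_zero_iff.1 (by simp [hz])
  have h' : x⁻¹ + y⁻¹ + z⁻¹ = 0 := by
    rw [Complex.inv_eq_conj hx, Complex.inv_eq_conj hy, Complex.inv_eq_conj hz, ← map_add,
      ← map_add, h, map_zero]
  field_simp at h'
  refine ⟨by linear_combination h' - z * h, ?_⟩
  rintro rfl
  have : 3 * x ^ 2 = 0 := by linear_combination 2 * x * h - h'
  exact hx0 (by simpa using this)

theorem exists_univ_eq_of_card_eq_five {ι : Type*} [Fintype ι] [DecidableEq ι]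
    (hι : Fintype.card ι = 5) {a b c : ι} (hab : a ≠ b) (hac : a ≠ c) (hbc : b ≠ c) :
    ∃ d e, d ≠ e ∧ a ≠ d ∧ a ≠ e ∧ b ≠ d ∧ b ≠ e ∧ c ≠ d ∧ c ≠ e ∧
      Finset.univ = ({a, b, c, d, e} : Finset ι) := by
  have h3 : ({a, b, c} : Finset ι).card = 3 := Finset.card_eq_three.2 ⟨a, b, c, hab, hac, hbc, rfl⟩
  have h2 : ({a, b, c} : Finset ι)ᶜ.card = 2 := by rw [Finset.card_compl, h3, hι]
  obtain ⟨d, e, hde, he⟩ := Finset.card_eq_two.1 h2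
  have key : ∀ x, x ∈ ({a, b, c} : Finset ι)ᶜ ↔ x ∈ ({d, e} : Finset ι) := fun x => by rw [he]
  simp only [Finset.mem_compl, Finset.mem_insert, Finset.mem_singleton] at key
  have hd := key d
  have he := key e
  have huniv : Finset.univ = ({a, b, c, d, e} : Finset ι) := by
    ext x
    have hx := key x
    simp only [Finset.mem_univ, Finset.mem_insert, Finset.mem_singleton, true_iff]
    tauto
  refine ⟨d, e, hde, ?_, ?_, ?_, ?_, ?_, ?_, huniv⟩ <;> rintro rfl <;> simp at hd he

/-- Vanishing sums of roots of unity are stable under Galois conjugation. -/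
theorem sum_pow_eq_zero_of_coprime {ι : Type*} [Fintype ι] {N k : ℕ} (hN : 0 < N)
    (hk : k.Coprime N) {z : ι → ℂ} (hz : ∀ i, z i ^ N = 1) (hsum : ∑ i, z i = 0) :
    ∑ i, z i ^ k = 0 := by
  have : NeZero N := ⟨hN.ne'⟩
  have hζ := Complex.isPrimitiveRoot_exp N hN.ne'
  set ζ := Complex.exp (2 * Real.pi * Complex.I / N)
  choose n _ hn using fun i => hζ.eq_pow_of_pow_eq_one (hz i)
  have hdvd : minpoly ℤ ζ ∣ ∑ i, (Polynomial.X : Polynomial ℤ) ^ n i := by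
    refine minpoly.isIntegrallyClosed_dvd (hζ.isIntegral hN) ?_
    simpa [hn] using hsum
  rw [hζ.minpoly_eq_pow_coprime hk] at hdvd
  have := Polynomial.aeval_eq_zero_of_dvd_aeval_eq_zero hdvd (minpoly.aeval ℤ (ζ ^ k))
  simpa [← pow_mul, mul_comm k, pow_mul _ _ k, hn] using this

theorem sum_inv_eq_zero_of_norm_eq_one {ι : Type*} [Fintype ι] {z : ι → ℂ}
    (hz : ∀ i, ‖z i‖ = 1) (hsum : ∑ i, z i = 0) : ∑ i, (z i)⁻¹ = 0 := by
  have := congrArg (starRingEnd ℂ) hsum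
  rw [map_sum, map_zero] at this
  rw [← this]
  exact Finset.sum_congr rfl fun i _ => Complex.inv_eq_conj (hz i)

/-- The hypotheses make the elementary symmetric functions `e₁`, `e₂`, `e₃`, `e₄` vanish, so that the
five numbers are the roots of `X ^ 5 - a * b * c * d * e`, which are simple. -/
theorem pow_five_eq_mul_and_ne {a b c d e : ℂ} (ha : a ≠ 0) (hb : b ≠ 0) (hc : c ≠ 0)
    (hd : d ≠ 0) (he : e ≠ 0) (h1 : a + b + c + d + e = 0)
    (h2 : a ^ 2 + b ^ 2 + c ^ 2 + d ^ 2 + e ^ 2 = 0)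
    (h3 : a⁻¹ + b⁻¹ + c⁻¹ + d⁻¹ + e⁻¹ = 0)
    (h4 : (a ^ 2)⁻¹ + (b ^ 2)⁻¹ + (c ^ 2)⁻¹ + (d ^ 2)⁻¹ + (e ^ 2)⁻¹ = 0) :
    a ^ 5 = a * b * c * d * e ∧ a ≠ b := by
  have e2 : a*b+a*c+a*d+a*e+b*c+b*d+b*e+c*d+c*e+d*e = 0 := by
    linear_combination (a+b+c+d+e)/2 * h1 - h2/2
  have e4 : b*c*d*e+a*c*d*e+a*b*d*e+a*b*c*e+a*b*c*d = 0 := by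
    field_simp at h3; linear_combination h3
  have e3' : a⁻¹*b⁻¹+a⁻¹*c⁻¹+a⁻¹*d⁻¹+a⁻¹*e⁻¹
      +b⁻¹*c⁻¹+b⁻¹*d⁻¹+b⁻¹*e⁻¹+c⁻¹*d⁻¹+c⁻¹*e⁻¹+d⁻¹*e⁻¹ = 0 := by
    simp only [← inv_pow] at h4
    linear_combination (a⁻¹+b⁻¹+c⁻¹+d⁻¹+e⁻¹)/2 * h3 - h4/2
  have e3 : c*d*e+b*d*e+b*c*e+b*c*d+a*d*e+a*c*e+a*c*d+a*b*e+a*b*d+a*b*c = 0 := by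
    field_simp at e3'; linear_combination e3'
  have h5 : a ^ 5 = a * b * c * d * e := by
    linear_combination a ^ 4 * h1 - a ^ 3 * e2 + a ^ 2 * e3 - a * e4
  refine ⟨h5, fun hab => ?_⟩
  subst hab
  have : 5 * a ^ 4 = 0 := by
    linear_combination 4 * a ^ 3 * h1 - 3 * a ^ 2 * e2 + 2 * a * e3 - e4
  exact ha (by simpa using this)

/-- If `a`, `b`, `c`, `d` sum to `e`, and so do their squares and their inverses, then `e` is a root of
`(X - a) * (X - b) * (X - c) * (X - d)`: this polynomial is `(X - e) * (X ^ 3 - a * b * c * d / e)`. -/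
theorem mul_sub_eq_zero_of_add_four_eq {a b c d e : ℂ} (ha : a ≠ 0) (hb : b ≠ 0) (hc : c ≠ 0)
    (hd : d ≠ 0) (he : e ≠ 0) (h1 : a + b + c + d = e)
    (h2 : a ^ 2 + b ^ 2 + c ^ 2 + d ^ 2 = e ^ 2)
    (h3 : a⁻¹ + b⁻¹ + c⁻¹ + d⁻¹ = e⁻¹) :
    (e - a) * (e - b) * (e - c) * (e - d) = 0 := by
  have e2 : a*b+a*c+a*d+b*c+b*d+c*d = 0 := by
    linear_combination (a+b+c+d+e)/2 * h1 - h2/2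
  have e3 : (b*c*d+a*c*d+a*b*d+a*b*c)*e = a*b*c*d := by
    field_simp at h3; linear_combination h3
  linear_combination -e^3 * h1 + e^2 * e2 - e3

/-- The conclusion is `e₁ * e₂ = e₃` for the elementary symmetric functions of `a`, `b`, `c`: the
first two agree with those of `d`, `e`, and comparing those of the inverses gives `e₃`. -/
theorem mul_add_eq_zero_of_add_three_eq {a b c d e : ℂ} (ha : a ≠ 0) (hb : b ≠ 0) (hc : c ≠ 0)
    (hd : d ≠ 0) (he : e ≠ 0) (h1 : a + b + c = d + e)
    (h2 : a ^ 2 + b ^ 2 + c ^ 2 = d ^ 2 + e ^ 2)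
    (h3 : a⁻¹ + b⁻¹ + c⁻¹ = d⁻¹ + e⁻¹)
    (h4 : (a ^ 2)⁻¹ + (b ^ 2)⁻¹ + (c ^ 2)⁻¹ = (d ^ 2)⁻¹ + (e ^ 2)⁻¹) :
    (a + b) * (b + c) * (c + a) = 0 := by
  have e2 : a*b+a*c+b*c = d*e := by
    linear_combination (a+b+c+d+e)/2 * h1 - h2/2
  have e2' : a⁻¹*b⁻¹+a⁻¹*c⁻¹+b⁻¹*c⁻¹ = d⁻¹*e⁻¹ := by
    simp only [← inv_pow] at h4
    linear_combination (a⁻¹+b⁻¹+c⁻¹+d⁻¹+e⁻¹)/2 * h3 - h4/2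
  have e3 : (a+b+c)*(d*e) = a*b*c := by
    field_simp at e2'; linear_combination e2'
  linear_combination e3 + (a + b + c) * e2

theorem pow_five_eq_of_power_sums {ι : Type*} [Fintype ι]
    (hι : Fintype.card ι = 5) {z : ι → ℂ} (hz : ∀ i, z i ≠ 0) (h1 : ∑ i, z i = 0)
    (h2 : ∑ i, z i ^ 2 = 0) (h3 : ∑ i, (z i)⁻¹ = 0) (h4 : ∑ i, (z i ^ 2)⁻¹ = 0) :
    (∀ i j, z i ^ 5 = z j ^ 5) ∧ Function.Injective z := by
  classical
  have key : ∀ i j, i ≠ j → z i ^ 5 = ∏ k, z k ∧ z i ≠ z j := by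
    intro a b hab
    obtain ⟨c, -, hc⟩ := Finset.exists_mem_notMem_of_card_lt_card
      (s := ({a, b} : Finset ι)) (t := Finset.univ)
      (Finset.card_le_two.trans_lt (by rw [Finset.card_univ, hι]; norm_num))
    simp only [Finset.mem_insert, Finset.mem_singleton, not_or] at hc
    obtain ⟨d, e, hde, had, hae, hbd, hbe, hcd, hce, huniv⟩ :=
      exists_univ_eq_of_card_eq_five hι hab (Ne.symm hc.1) (Ne.symm hc.2)
    have n1 : a ∉ ({b, c, d, e} : Finset ι) := by grind
    have n2 : b ∉ ({c, d, e} : Finset ι) := by grind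
    have n3 : c ∉ ({d, e} : Finset ι) := by grind
    have n4 : d ∉ ({e} : Finset ι) := by grind
    rw [huniv, Finset.sum_insert n1, Finset.sum_insert n2, Finset.sum_insert n3,
      Finset.sum_insert n4, Finset.sum_singleton] at h1 h2 h3 h4
    rw [huniv, Finset.prod_insert n1, Finset.prod_insert n2, Finset.prod_insert n3,
      Finset.prod_insert n4, Finset.prod_singleton]
    simp only [← add_assoc] at h1 h2 h3 h4
    simp only [← mul_assoc]
    exact pow_five_eq_mul_and_ne (hz a) (hz b) (hz c) (hz d) (hz e) h1 h2 h3 h4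
  refine ⟨fun i j => ?_, fun i j hij => ?_⟩
  · rcases eq_or_ne i j with rfl | hij
    · rfl
    · rw [(key i j hij).1, (key j i hij.symm).1]
  · by_contra hne
    exact (key i j hne).2 hij

/-- The case of `pow_five_eq_of_sum_eq_zero` in which every `z i` is, up to the sign `z i ^ m`, a
root of unity of odd order, and at least three of the signs are positive. -/
theorem pow_five_eq_of_three_le_card {ι : Type*} [Fintype ι]
    (hι : Fintype.card ι = 5) {m : ℕ} (hm : Odd m) {z : ι → ℂ} (hz : ∀ i, z i ^ (2 * m) = 1)
    (hsum : ∑ i, z i = 0) (hneg : ∀ i j, z i ≠ -z j)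
    (h3 : 3 ≤ (Finset.univ.filter fun i => z i ^ m = 1).card) :
    (∀ i j, z i ^ 5 = z j ^ 5) ∧ Function.Injective z := by
  classical
  have hm0 : 0 < m := hm.pos
  have hz0 : ∀ i, z i ≠ 0 := fun i h => by
    have := hz i
    rw [h, zero_pow (by omega)] at this
    exact zero_ne_one this
  have hnorm : ∀ i, ‖z i‖ = 1 := fun i => Complex.norm_eq_one_of_pow_eq_one (hz i) (by omega)
  have hε : ∀ i, z i ^ m = 1 ∨ z i ^ m = -1 := fun i =>
    sq_eq_one_iff.1 (by rw [← pow_mul, mul_comm, hz])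
  -- `z ↦ z ^ (m + 2)` multiplies `z ^ 2` by the sign `z ^ m`
  have hcop : (m + 2).Coprime (2 * m) := by
    rw [Nat.coprime_mul_iff_right]
    constructor
    · exact Nat.coprime_two_right.2 (by grind)
    · rw [Nat.coprime_self_add_left]; exact Nat.coprime_two_left.2 hm
  have hsq := sum_pow_eq_zero_of_coprime (by omega) hcop hz hsum
  have hinv := sum_inv_eq_zero_of_norm_eq_one hnorm hsum
  have hsqinv := sum_inv_eq_zero_of_norm_eq_one (z := fun i => z i ^ (m + 2))
    (fun i => by rw [norm_pow, hnorm, one_pow]) hsq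
  by_cases hall : ∀ i, z i ^ m = 1
  · simp only [pow_add, hall, one_mul] at hsq hsqinv
    exact pow_five_eq_of_power_sums hι hz0 hsum hsq hinv hsqinv
  exfalso
  obtain ⟨t, ht, htc⟩ := Finset.exists_subset_card_eq h3
  obtain ⟨a, b, c, hab, hac, hbc, rfl⟩ := Finset.card_eq_three.1 htc
  obtain ⟨d, e, hde, had, hae, hbd, hbe, hcd, hce, huniv⟩ :=
    exists_univ_eq_of_card_eq_five hι hab hac hbc
  have hea : z a ^ m = 1 := by simpa using ht (show a ∈ _ by simp)
  have heb : z b ^ m = 1 := by simpa using ht (show b ∈ _ by simp)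
  have hec : z c ^ m = 1 := by simpa using ht (show c ∈ _ by simp)
  have n1 : a ∉ ({b, c, d, e} : Finset ι) := by grind
  have n2 : b ∉ ({c, d, e} : Finset ι) := by grind
  have n3 : c ∉ ({d, e} : Finset ι) := by grind
  have n4 : d ∉ ({e} : Finset ι) := by grind
  rw [huniv, Finset.sum_insert n1, Finset.sum_insert n2, Finset.sum_insert n3,
    Finset.sum_insert n4, Finset.sum_singleton] at hsum hsq hinv hsqinv
  have hmem : ∀ i, i = a ∨ i = b ∨ i = c ∨ i = d ∨ i = e := fun i => by
    have := Finset.mem_univ i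
    rw [huniv] at this
    simpa using this
  simp only [pow_add, hea, heb, hec, one_mul] at hsq hsqinv
  have cancel : ∀ i j, z i + z j ≠ 0 := fun i j h => hneg i j (eq_neg_of_add_eq_zero_left h)
  have four : ∀ d e, (z d ^ m = 1) → (z e ^ m = -1) →
      z a + z b + z c + z d + z e = 0 →
      z a ^ 2 + z b ^ 2 + z c ^ 2 + z d ^ 2 = z e ^ 2 →
      (z a)⁻¹ + (z b)⁻¹ + (z c)⁻¹ + (z d)⁻¹ + (z e)⁻¹ = 0 → False := by
    intro d e hd he h1 h2 h3
    have := mul_sub_eq_zero_of_add_four_eq (hz0 a) (hz0 b) (hz0 c) (hz0 d)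
      (neg_ne_zero.2 (hz0 e)) (by linear_combination h1) (by linear_combination h2)
      (by rw [inv_neg]; linear_combination h3)
    have hsub : ∀ i, -z e - z i ≠ 0 := fun i h => cancel e i (by linear_combination -h)
    simp [hsub] at this
  rcases hε d with hd | hd <;> rcases hε e with he | he <;>
    simp only [hd, he, one_mul, neg_mul, inv_neg] at hsq hsqinv
  · exact hall fun i => by rcases hmem i with rfl | rfl | rfl | rfl | rfl <;> assumption
  · exact four d e hd he (by linear_combination hsum) (by linear_combination hsq)
      (by linear_combination hinv)
  · exact four e d he hd (by linear_combination hsum) (by linear_combination hsq)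
      (by linear_combination hinv)
  · have := mul_add_eq_zero_of_add_three_eq (hz0 a) (hz0 b) (hz0 c) (neg_ne_zero.2 (hz0 d))
      (neg_ne_zero.2 (hz0 e)) (by linear_combination hsum) (by linear_combination hsq)
      (by rw [inv_neg, inv_neg]; linear_combination hinv)
      (by rw [neg_sq, neg_sq]; linear_combination hsqinv)
    simp [cancel] at this

theorem pow_five_eq_of_pow_two_mul_odd {ι : Type*} [Fintype ι]
    (hι : Fintype.card ι = 5) {m : ℕ} (hm : Odd m) {z : ι → ℂ} (hz : ∀ i, z i ^ (2 * m) = 1)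
    (hsum : ∑ i, z i = 0) (hneg : ∀ i j, z i ≠ -z j) :
    (∀ i j, z i ^ 5 = z j ^ 5) ∧ Function.Injective z := by
  classical
  by_cases h3 : 3 ≤ (Finset.univ.filter fun i => z i ^ m = 1).card
  · exact pow_five_eq_of_three_le_card hι hm hz hsum hneg h3
  -- otherwise replace `z` by `-z`
  have hε : ∀ i, z i ^ m ≠ 1 → z i ^ m = -1 := fun i =>
    (sq_eq_one_iff.1 (by rw [← pow_mul, mul_comm, hz])).resolve_left
  have := pow_five_eq_of_three_le_card hι hm (z := fun i => -z i)
    (fun i => by rw [(even_two_mul m).neg_pow, hz]) (by rw [Finset.sum_neg_distrib, hsum, neg_zero])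
    (fun i j h => hneg i j (neg_injective h)) (by
      have h := Finset.card_filter_add_card_filter_not (s := Finset.univ) (fun i => z i ^ m = 1)
      rw [Finset.card_univ, hι] at h
      have : (Finset.univ.filter fun i => ¬ z i ^ m = 1).card ≤
          (Finset.univ.filter fun i => (-z i) ^ m = 1).card := by
        refine Finset.card_le_card fun i hi => ?_
        simp only [Finset.mem_filter, Finset.mem_univ, true_and] at hi ⊢
        rw [hm.neg_pow, hε i hi, neg_neg]
      omega)
  refine ⟨fun i j => ?_, fun i j hij => this.2 (congrArg Neg.neg hij)⟩
  have h := this.1 i j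
  simp only [Odd.neg_pow (show Odd 5 by decide)] at h
  exact neg_injective h

theorem two_lt_card_of_sum_eq_zero {ι : Type*} {z : ι → ℂ} {s : Finset ι} (hs : s.Nonempty)
    (hsum : ∑ i ∈ s, z i = 0) (hz : ∀ i, z i ≠ 0) (hneg : ∀ i j, z i ≠ -z j) : 2 < s.card := by
  classical
  by_contra! hle
  have hpos := hs.card_pos
  interval_cases h : s.card
  · obtain ⟨i, rfl⟩ := Finset.card_eq_one.1 h
    exact hz i (by simpa using hsum)
  · obtain ⟨i, j, hij, rfl⟩ := Finset.card_eq_two.1 h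
    rw [Finset.sum_pair hij] at hsum
    exact hneg i j (eq_neg_of_add_eq_zero_left hsum)

/-- Five roots of unity with sum zero, no two of which cancel, are the rotated fifth roots of unity.
If `4` divides the common order, a Galois automorphism splits the sum into two vanishing sums, one
of which has at most two terms; this reduces the claim to the order `2 * m` with `m` odd. -/
theorem pow_five_eq_of_sum_eq_zero {ι : Type*} [Fintype ι]
    (hι : Fintype.card ι = 5) {m : ℕ} (hm : Odd m) (s : ℕ) {z : ι → ℂ}
    (hz : ∀ i, z i ^ (2 ^ s * m) = 1) (hsum : ∑ i, z i = 0) (hneg : ∀ i j, z i ≠ -z j) :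
    (∀ i j, z i ^ 5 = z j ^ 5) ∧ Function.Injective z := by
  classical
  induction s generalizing z with
  | zero =>
    exact pow_five_eq_of_pow_two_mul_odd hι hm
      (fun i => by rw [mul_comm, pow_mul, show z i ^ m = 1 by simpa using hz i, one_pow])
      hsum hneg
  | succ s ih =>
    rcases s with _ | s
    · exact pow_five_eq_of_pow_two_mul_odd hι hm (by simpa using hz) hsum hneg
    have hm0 : 0 < m := hm.pos
    set h := 2 ^ (s + 1) * m with hh
    have hpos : 0 < h := by positivity
    have hN : 2 ^ (s + 1 + 1) * m = 2 * h := by rw [hh]; ring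
    have heven : Even h := ⟨2 ^ s * m, by rw [hh]; ring⟩
    rw [hN] at hz
    have hz0 : ∀ i, z i ≠ 0 := fun i h => by
      have := hz i
      rw [h, zero_pow (by omega)] at this
      exact zero_ne_one this
    have hε : ∀ i, z i ^ h = 1 ∨ z i ^ h = -1 := fun i =>
      sq_eq_one_iff.1 (by rw [← pow_mul, mul_comm, hz])
    -- `z ↦ z ^ (h + 1)` fixes the roots of unity of order `h` and negates the others
    have hcop : (h + 1).Coprime (2 * h) := by
      rw [Nat.coprime_mul_iff_right]
      exact ⟨Nat.coprime_two_right.2 heven.add_one, by simp⟩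
    have hσ := sum_pow_eq_zero_of_coprime (by omega) hcop hz hsum
    have hplus : ∑ i with z i ^ h = 1, z i = 0 := by
      have : ∑ i, (z i ^ (h + 1) + z i) = 2 * ∑ i with z i ^ h = 1, z i := by
        rw [Finset.sum_filter, Finset.mul_sum]
        refine Finset.sum_congr rfl fun i _ => ?_
        rcases hε i with h1 | h1
        · rw [pow_succ, h1, if_pos rfl]; ring
        · rw [pow_succ, h1, if_neg (by norm_num)]; ring
      rw [Finset.sum_add_distrib, hσ, hsum, add_zero] at this
      simpa using this.symm
    have hminus : ∑ i with ¬ z i ^ h = 1, z i = 0 := by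
      have := Finset.sum_filter_add_sum_filter_not Finset.univ (fun i => z i ^ h = 1) z
      rwa [hplus, hsum, zero_add] at this
    have hcard := Finset.card_filter_add_card_filter_not (s := Finset.univ) (fun i => z i ^ h = 1)
    rw [Finset.card_univ, hι] at hcard
    rcases Finset.eq_empty_or_nonempty (Finset.univ.filter fun i => z i ^ h = 1) with h1 | h1
    · have hall : ∀ i, z i ^ h = -1 := fun i =>
        (hε i).resolve_left fun hi => by
          have : i ∈ (Finset.univ.filter fun i => z i ^ h = 1) := by simpa using hi
          rw [h1] at this; simp at this
      have : Nonempty ι := Fintype.card_pos_iff.1 (by omega)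
      obtain ⟨i₀⟩ := this
      have key := ih (z := fun i => z i / z i₀)
        (fun i => by rw [div_pow, hall, hall, div_self (by norm_num)])
        (by rw [← Finset.sum_div, hsum, zero_div])
        (fun i j hij => hneg i j (by
          rw [← neg_div] at hij
          exact (div_left_inj' (hz0 _)).1 hij))
      refine ⟨fun i j => ?_, fun i j hij => key.2 (congrArg (· / z i₀) hij)⟩
      have := key.1 i j
      rw [div_pow, div_pow] at this
      exact (div_left_inj' (pow_ne_zero _ (hz0 _))).1 this
    rcases Finset.eq_empty_or_nonempty (Finset.univ.filter fun i => ¬ z i ^ h = 1) with h2 | h2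
    · refine ih (fun i => ?_) hsum hneg
      by_contra hi
      have : i ∈ (Finset.univ.filter fun i => ¬ z i ^ h = 1) := by simpa using hi
      rw [h2] at this; simp at this
    have := two_lt_card_of_sum_eq_zero h1 hplus hz0 hneg
    have := two_lt_card_of_sum_eq_zero h2 hminus hz0 hneg
    omega

/-! ### Rows of type two-three -/

/-- Additive form of the shape of five roots of unity made up of a pair `α, -α`, at the two indices
in `P`, and a triple `β, β * ω, β * ω ^ 2`, at the three others, where `ω` is a primitive cube root
of unity. The roots of unity are written as exponents; `f` records their components of 2-power
order, `g` those of odd order, and `s` is the exponent of `-1`. Thus `f` sees only the sign change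
inside the pair, and `g` sees only the arithmetic progression formed by the triple. The values lie
in a ring because the exponents do, but only its addition is used. -/
structure IsTwoThree {ι M : Type*} [CommRing M] (s : M) (P : Finset ι) (f g : ι → M) :
    Prop where
  card_eq : P.card = 2
  eq_add : ∀ x ∈ P, ∀ y ∈ P, x ≠ y → f x = f y + s
  eq_of_notMem : ∀ x ∉ P, ∀ y ∉ P, f x = f y
  eq_of_mem : ∀ x ∈ P, ∀ y ∈ P, g x = g y
  ne_of_notMem : ∀ x ∉ P, ∀ y ∉ P, x ≠ y → g x ≠ g y
  add_eq : ∀ x ∉ P, ∀ y ∉ P, ∀ z ∉ P, x ≠ y → x ≠ z → y ≠ z → g x + g y = g z + g z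

namespace IsTwoThree

variable {ι M : Type*} [Fintype ι] [DecidableEq ι] [CommRing M] {s : M} {P Q R : Finset ι}
  {u v u' v' : ι → M}

/-! The rows of the matrix are normalised by the first one, which becomes zero; `u` and `v` stand
for two others, so that `P`, `Q`, `R` are the cancelling pairs of three rows. -/

theorem ne (hι : Fintype.card ι = 5) (hs : s ≠ 0) (h2s : s + s = 0) (hP : IsTwoThree s P u u')
    (hQ : IsTwoThree s Q v v') (hR : IsTwoThree s R (v - u) (v' - u')) : P ≠ Q := by
  rintro rfl
  obtain ⟨a, b, hab, hPe⟩ := Finset.card_eq_two.1 hP.card_eq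
  obtain ⟨r, t, hrt, hRe⟩ := Finset.card_eq_two.1 hR.card_eq
  obtain ⟨c, -, hc⟩ := Finset.exists_mem_notMem_of_card_lt_card (s := P) (t := Finset.univ)
    (by rw [Finset.card_univ, hι, hP.card_eq]; norm_num)
  simp only [hPe, Finset.mem_insert, Finset.mem_singleton, not_or] at hc
  obtain ⟨d, e, hde, had, hae, hbd, hbe, hcd, hce, huniv⟩ :=
    exists_univ_eq_of_card_eq_five hι hab (Ne.symm hc.1) (Ne.symm hc.2)
  have hmem : ∀ i, i = a ∨ i = b ∨ i = c ∨ i = d ∨ i = e := fun i => by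
    have := Finset.mem_univ i
    rw [huniv] at this
    simpa using this
  have hoff : ∀ x y, x ≠ r → x ≠ t → y ≠ r → y ≠ t → v x - u x = v y - u y := by
    intro x y h1 h2 h3 h4
    exact hR.eq_of_notMem x (by simp [*]) y (by simp [*])
  have hon : v r - u r = v t - u t + s := hR.eq_add r (by simp [hRe]) t (by simp [hRe]) hrt
  have f1 := hP.eq_add a (by simp [hPe]) b (by simp [hPe]) hab
  have f2 := hP.eq_of_notMem c (by simp [hPe, hc]) d (by simp [hPe, had.symm, hbd.symm])
  have f3 := hP.eq_of_notMem c (by simp [hPe, hc]) e (by simp [hPe, hae.symm, hbe.symm])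
  have g1 := hQ.eq_add a (by simp [hPe]) b (by simp [hPe]) hab
  have g2 := hQ.eq_of_notMem c (by simp [hPe, hc]) d (by simp [hPe, had.symm, hbd.symm])
  have g3 := hQ.eq_of_notMem c (by simp [hPe, hc]) e (by simp [hPe, hae.symm, hbe.symm])
  clear hPe hRe huniv hP hQ hR
  rcases hmem r with rfl | rfl | rfl | rfl | rfl <;>
    rcases hmem t with rfl | rfl | rfl | rfl | rfl <;> clear hmem <;> grind

theorem not_disjoint (hι : Fintype.card ι = 5) (hs : s ≠ 0) (h2s : s + s = 0)
    (hP : IsTwoThree s P u u')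
    (hQ : IsTwoThree s Q v v') (hR : IsTwoThree s R (v - u) (v' - u')) : ¬ Disjoint P Q := by
  intro hdisj
  obtain ⟨a, b, hab, hPe⟩ := Finset.card_eq_two.1 hP.card_eq
  obtain ⟨c, d, hcd, hQe⟩ := Finset.card_eq_two.1 hQ.card_eq
  obtain ⟨r, t, hrt, hRe⟩ := Finset.card_eq_two.1 hR.card_eq
  have hn : ∀ x ∈ P, ∀ y ∈ Q, x ≠ y := fun x hx y hy h =>
    Finset.disjoint_left.1 hdisj hx (h ▸ hy)
  have hac := hn a (by simp [hPe]) c (by simp [hQe])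
  have had := hn a (by simp [hPe]) d (by simp [hQe])
  have hbc := hn b (by simp [hPe]) c (by simp [hQe])
  have hbd := hn b (by simp [hPe]) d (by simp [hQe])
  obtain ⟨e, -, he⟩ := Finset.exists_mem_notMem_of_card_lt_card
    (s := ({a, b, c, d} : Finset ι)) (t := Finset.univ)
    (Finset.card_le_four.trans_lt (by rw [Finset.card_univ, hι]; norm_num))
  simp only [Finset.mem_insert, Finset.mem_singleton, not_or] at he
  obtain ⟨hea, heb, hec, hed⟩ := he
  have hmem : ∀ i, i = a ∨ i = b ∨ i = c ∨ i = d ∨ i = e := fun i => by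
    have huniv : ({a, b, c, d, e} : Finset ι) = Finset.univ := by
      apply Finset.eq_univ_of_card
      rw [Finset.card_insert_of_notMem (by grind), Finset.card_insert_of_notMem (by grind),
        Finset.card_insert_of_notMem (by grind), Finset.card_insert_of_notMem (by grind),
        Finset.card_singleton, hι]
    have := Finset.mem_univ i
    rw [← huniv] at this
    simpa using this
  have hoff : ∀ x y, x ≠ r → x ≠ t → y ≠ r → y ≠ t → v x - u x = v y - u y := by
    intro x y h1 h2 h3 h4
    exact hR.eq_of_notMem x (by simp [*]) y (by simp [*])
  have hon : v r - u r = v t - u t + s := hR.eq_add r (by simp [hRe]) t (by simp [hRe]) hrt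
  have f1 := hP.eq_add a (by simp [hPe]) b (by simp [hPe]) hab
  have f2 := hP.eq_of_notMem c (by simp [hPe, hac.symm, hbc.symm]) d
    (by simp [hPe, had.symm, hbd.symm])
  have f3 := hP.eq_of_notMem c (by simp [hPe, hac.symm, hbc.symm]) e (by simp [hPe, hea, heb])
  have g1 := hQ.eq_add c (by simp [hQe]) d (by simp [hQe]) hcd
  have g2 := hQ.eq_of_notMem a (by simp [hQe, hac, had]) b (by simp [hQe, hbc, hbd])
  have g3 := hQ.eq_of_notMem a (by simp [hQe, hac, had]) e (by simp [hQe, hec, hed])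
  have k1 := hoff a e
  have k2 := hoff b e
  have k3 := hoff c e
  have k4 := hoff d e
  have k5 := hoff a c
  have k6 := hoff a b
  have k7 := hoff b c
  have k8 := hoff c d
  clear hPe hRe hQe hn hdisj hP hQ hR hoff
  rcases hmem r with rfl | rfl | rfl | rfl | rfl <;>
    rcases hmem t with rfl | rfl | rfl | rfl | rfl <;> clear hmem <;> grind

/-- The cancelling pairs of three rows are the edges of a triangle. Only the components of 2-power
order enter. -/
theorem exists_triangle (hι : Fintype.card ι = 5) (hs : s ≠ 0) (h2s : s + s = 0)
    (hP : IsTwoThree s P u u')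
    (hQ : IsTwoThree s Q v v') (hR : IsTwoThree s R (v - u) (v' - u')) :
    ∃ a b c, a ≠ b ∧ a ≠ c ∧ b ≠ c ∧ P = {a, b} ∧ Q = {a, c} ∧ R = {b, c} := by
  obtain ⟨a, haP, haQ⟩ := Finset.not_disjoint_iff.1 (hP.not_disjoint hι hs h2s hQ hR)
  obtain ⟨b, hb⟩ := Finset.card_eq_one.1
    (show (P.erase a).card = 1 by rw [Finset.card_erase_of_mem haP, hP.card_eq])
  obtain ⟨c, hc⟩ := Finset.card_eq_one.1
    (show (Q.erase a).card = 1 by rw [Finset.card_erase_of_mem haQ, hQ.card_eq])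
  have hPe : P = {a, b} := by rw [← Finset.insert_erase haP, hb]
  have hQe : Q = {a, c} := by rw [← Finset.insert_erase haQ, hc]
  have hab : a ≠ b := fun h => by have := hP.card_eq; simp [hPe, h] at this
  have hac : a ≠ c := fun h => by have := hQ.card_eq; simp [hQe, h] at this
  have hbc : b ≠ c := fun h => hP.ne hι hs h2s hQ hR (by rw [hPe, hQe, h])
  refine ⟨a, b, c, hab, hac, hbc, hPe, hQe, ?_⟩
  obtain ⟨r, t, hrt, hRe⟩ := Finset.card_eq_two.1 hR.card_eq
  obtain ⟨d, e, hde, had, hae, hbd, hbe, hcd, hce, huniv⟩ :=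
    exists_univ_eq_of_card_eq_five hι hab hac hbc
  have hmem : ∀ i, i = a ∨ i = b ∨ i = c ∨ i = d ∨ i = e := fun i => by
    have := Finset.mem_univ i
    rw [huniv] at this
    simpa using this
  have hoff : ∀ x y, x ≠ r → x ≠ t → y ≠ r → y ≠ t → v x - u x = v y - u y := by
    intro x y h1 h2 h3 h4
    exact hR.eq_of_notMem x (by simp [*]) y (by simp [*])
  have hon : v r - u r = v t - u t + s := hR.eq_add r (by simp [hRe]) t (by simp [hRe]) hrt
  have f1 := hP.eq_add a (by simp [hPe]) b (by simp [hPe]) hab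
  have f2 := hP.eq_of_notMem c (by simp [hPe, hac.symm, hbc.symm]) d
    (by simp [hPe, had.symm, hbd.symm])
  have f3 := hP.eq_of_notMem c (by simp [hPe, hac.symm, hbc.symm]) e
    (by simp [hPe, hae.symm, hbe.symm])
  have g1 := hQ.eq_add a (by simp [hQe]) c (by simp [hQe]) hac
  have g2 := hQ.eq_of_notMem b (by simp [hQe, hab.symm, hbc]) d
    (by simp [hQe, had.symm, hcd.symm])
  have g3 := hQ.eq_of_notMem b (by simp [hQe, hab.symm, hbc]) e
    (by simp [hQe, hae.symm, hce.symm])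
  suffices h : (r = b ∧ t = c) ∨ (r = c ∧ t = b) by
    rcases h with ⟨rfl, rfl⟩ | ⟨rfl, rfl⟩
    · exact hRe
    · rw [hRe, Finset.pair_comm]
  clear hPe hRe hQe huniv hb hc hP hQ hR haP haQ
  rcases hmem r with rfl | rfl | rfl | rfl | rfl <;>
    rcases hmem t with rfl | rfl | rfl | rfl | rfl <;> clear hmem <;> grind

/-- The components of odd order are constant on the triangle formed by the cancelling pairs. -/
theorem eq_of_triangle (hι : Fintype.card ι = 5) {a b c : ι} (hab : a ≠ b) (hac : a ≠ c)
    (hbc : b ≠ c) (hu : ∀ x y, 4 * u' x = 4 * u' y → u' x = u' y)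
    (hv : ∀ x y, 4 * v' x = 4 * v' y → v' x = v' y)
    (hP : IsTwoThree s {a, b} u u') (hQ : IsTwoThree s {a, c} v v')
    (hR : IsTwoThree s {b, c} (v - u) (v' - u')) : u' a = u' c ∧ v' a = v' b := by
  obtain ⟨d, e, hde, had, hae, hbd, hbe, hcd, hce, -⟩ :=
    exists_univ_eq_of_card_eq_five hι hab hac hbc
  have h1 := hP.add_eq d (by grind) e (by grind) c (by grind) hde hcd.symm hce.symm
  have h2 := hQ.add_eq d (by grind) e (by grind) b (by grind) hde hbd.symm hbe.symm
  have h3 := hR.add_eq d (by grind) e (by grind) a (by grind) hde had.symm hae.symm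
  have h4 := hP.eq_of_mem a (by simp) b (by simp)
  have h5 := hQ.eq_of_mem a (by simp) c (by simp)
  have h6 := hR.eq_of_mem b (by simp) c (by simp)
  simp only [Pi.sub_apply] at h3 h6
  exact ⟨hu _ _ (by grind), hv _ _ (by grind)⟩

theorem three_mul_sub_eq_zero (hι : Fintype.card ι = 5) (hP : IsTwoThree s P u u') {x y : ι}
    (hx : x ∉ P) (hy : y ∉ P) (hxy : x ≠ y) : 3 * (u' x - u' y) = 0 := by
  obtain ⟨z, -, hz⟩ := Finset.exists_mem_notMem_of_card_lt_card
    (s := insert x (insert y P)) (t := Finset.univ) (by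
      have h1 := Finset.card_insert_le x (insert y P)
      have h2 := Finset.card_insert_le y P
      rw [hP.card_eq] at h2
      rw [Finset.card_univ, hι]
      omega)
  simp only [Finset.mem_insert, not_or] at hz
  have h1 := hP.add_eq x hx z hz.2.2 y hy (Ne.symm hz.1) hxy hz.2.1
  have h2 := hP.add_eq y hy z hz.2.2 x hx (Ne.symm hz.2.1) hxy.symm hz.1
  linear_combination h1 - h2

/-- Four rows cannot all be pairwise of type two-three. All the triangles coincide, and at an index
`d` off the triangle the three differences of `u'`, `v'`, `w'` from their constant values on it are
distinct nonzero elements killed by `3`, of which there are only two. -/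
theorem false_of_four_rows (hι : Fintype.card ι = 5) (hs : s ≠ 0) (h2s : s + s = 0)
    (h3 : ∀ x y : M, 3 * x = 0 → 3 * y = 0 → x ≠ 0 → y ≠ 0 → x = y ∨ x + y = 0)
    {w w' : ι → M} {S T U : Finset ι}
    (hu : ∀ x y, 4 * u' x = 4 * u' y → u' x = u' y)
    (hv : ∀ x y, 4 * v' x = 4 * v' y → v' x = v' y)
    (hw : ∀ x y, 4 * w' x = 4 * w' y → w' x = w' y)
    (hP : IsTwoThree s P u u') (hQ : IsTwoThree s Q v v') (hR : IsTwoThree s R w w')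
    (hS : IsTwoThree s S (v - u) (v' - u')) (hT : IsTwoThree s T (w - u) (w' - u'))
    (hU : IsTwoThree s U (w - v) (w' - v')) : False := by
  have hQR := hQ.ne hι hs h2s hR hU
  obtain ⟨a, b, c, hab, hac, hbc, rfl, rfl, rfl⟩ := hP.exists_triangle hι hs h2s hQ hS
  obtain ⟨huac, hvab⟩ := eq_of_triangle hι hab hac hbc hu hv hP hQ hS
  obtain ⟨a', b', c', hab', hac', hbc', hPe, rfl, rfl⟩ := hP.exists_triangle hι hs h2s hR hT
  obtain ⟨huac', hwab'⟩ := eq_of_triangle hι hab' hac' hbc' hu hw (hPe ▸ hP) hR hT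
  have hset : ∀ x, (x = a ∨ x = b) ↔ (x = a' ∨ x = b') := fun x => by
    have : x ∈ ({a, b} : Finset ι) ↔ x ∈ ({a', b'} : Finset ι) := by rw [hPe]
    simpa using this
  have huab := hP.eq_of_mem a (by simp) b (by simp)
  -- off `{a, b}` the values of `u'` are distinct, so only `c` shares the value of `a`
  have hcc : c' = c := by
    by_contra hne
    have h1 := hset a'
    have h2 := hset c'
    refine hP.ne_of_notMem c' (by grind) c (by grind) hne ?_
    rw [← huac, ← huac']
    rcases h1.2 (Or.inl rfl) with rfl | rfl
    · rfl
    · exact huab.symm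
  subst hcc
  have haa : a' = b := by
    rcases (hset a').2 (Or.inl rfl) with rfl | rfl
    · exact absurd rfl hQR
    · rfl
  subst haa
  have hbb : b' = a := by
    have := hset b'
    grind
  subst hbb
  have hUe : U = {b', a'} := by
    obtain ⟨x, y, z, hxy, hxz, hyz, h1, h2, rfl⟩ := hQ.exists_triangle hι hs h2s hR hU
    have k1 : ∀ t, (t = b' ∨ t = c') ↔ (t = x ∨ t = y) := fun t => by
      have : t ∈ ({b', c'} : Finset ι) ↔ t ∈ ({x, y} : Finset ι) := by rw [h1]
      simpa using this
    have k2 : ∀ t, (t = a' ∨ t = c') ↔ (t = x ∨ t = z) := fun t => by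
      have : t ∈ ({a', c'} : Finset ι) ↔ t ∈ ({x, z} : Finset ι) := by rw [h2]
      simpa using this
    have := k1 c'
    have := k2 c'
    have := k1 b'
    have := k2 a'
    have : x = c' := by grind
    subst this
    have : y = b' := by grind
    have : z = a' := by grind
    subst y z
    rfl
  subst hUe
  obtain ⟨d, e, hde, had, hae, hbd, hbe, hcd, hce, -⟩ :=
    exists_univ_eq_of_card_eq_five hι hab hac hbc
  have q1 := hQ.eq_of_mem b' (by simp) c' (by simp)
  have q2 := hR.eq_of_mem a' (by simp) c' (by simp)
  have t1 := hP.three_mul_sub_eq_zero hι (x := d) (y := c') (by grind) (by grind) (by grind)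
  have t2 := hQ.three_mul_sub_eq_zero hι (x := d) (y := a') (by grind) (by grind) (by grind)
  have t3 := hR.three_mul_sub_eq_zero hι (x := d) (y := b') (by grind) (by grind) (by grind)
  have n1 := hP.ne_of_notMem d (by grind) c' (by grind) (by grind)
  have n2 := hQ.ne_of_notMem d (by grind) a' (by grind) (by grind)
  have n3 := hR.ne_of_notMem d (by grind) b' (by grind) (by grind)
  have m1 := hS.ne_of_notMem d (by grind) b' (by grind) (by grind)
  have m2 := hT.ne_of_notMem d (by grind) a' (by grind) (by grind)
  have m3 := hU.ne_of_notMem d (by grind) c' (by grind) (by grind)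
  simp only [Pi.sub_apply] at m1 m2 m3
  rcases h3 _ _ t1 t2 (sub_ne_zero.2 n1) (sub_ne_zero.2 n2) with h12 | h12
  · exact m1 (by linear_combination -h12 + huac - hvab)
  rcases h3 _ _ t1 t3 (sub_ne_zero.2 n1) (sub_ne_zero.2 n3) with h13 | h13
  · exact m2 (by grind)
  exact m3 (by grind)

end IsTwoThree

/-! ### Sets of five elements -/

theorem ZMod.exists_stdAddChar_eq {N : ℕ} [NeZero N] {z : ℂ} (hz : z ^ N = 1) :
    ∃ e : ZMod N, ZMod.stdAddChar e = z := by
  obtain ⟨k, _, rfl⟩ := (Complex.isPrimitiveRoot_exp N (NeZero.ne N)).eq_pow_of_pow_eq_one hz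
  refine ⟨((k : ℤ) : ZMod N), ?_⟩
  rw [ZMod.stdAddChar_coe, ← Complex.exp_nat_mul]
  congr 1
  push_cast
  ring

theorem ZMod.eq_or_add_eq_zero_of_three_mul {N : ℕ} [NeZero N] (x y : ZMod N) (hx : 3 * x = 0)
    (hy : 3 * y = 0) (hx0 : x ≠ 0) (hy0 : y ≠ 0) : x = y ∨ x + y = 0 := by
  have key : ∀ t : ZMod N, 3 * t = 0 → t ≠ 0 → 3 * t.val = N ∨ 3 * t.val = 2 * N := by
    intro t ht ht0
    have h1 : ((3 * t.val : ℕ) : ZMod N) = 0 := by push_cast; rw [ZMod.natCast_zmod_val, ht]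
    obtain ⟨c, hc⟩ := (ZMod.natCast_eq_zero_iff _ _).1 h1
    have h2 := ZMod.val_lt t
    have h3 : t.val ≠ 0 := (ZMod.val_ne_zero t).2 ht0
    have h4 : c < 3 := by
      by_contra! h
      nlinarith
    interval_cases c <;> omega
  rcases key x hx hx0 with h1 | h1 <;> rcases key y hy hy0 with h2 | h2
  · exact Or.inl (ZMod.val_injective N (by omega))
  · right
    rw [← ZMod.natCast_zmod_val x, ← ZMod.natCast_zmod_val y, ← Nat.cast_add,
      show x.val + y.val = N by omega, ZMod.natCast_self]
  · right
    rw [← ZMod.natCast_zmod_val x, ← ZMod.natCast_zmod_val y, ← Nat.cast_add,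
      show x.val + y.val = N by omega, ZMod.natCast_self]
  · exact Or.inl (ZMod.val_injective N (by omega))

/-- A vanishing sum of five roots of unity of order dividing `N` with a cancelling pair is of type
two-three. For `N = 2 ^ k * m` with `m` odd, multiplication of the exponents by `m` and by `2 ^ k`
isolates the components of 2-power order and of odd order; `N` is even so that `-1` occurs. -/
theorem isTwoThree_of_sum_eq_zero {ι : Type*} [Fintype ι] [DecidableEq ι]
    (hι : Fintype.card ι = 5) {h k m N : ℕ} [NeZero N] (hN : N = 2 * h) (hNm : N = 2 ^ k * m)
    (hm : Odd m) (d : ι → ZMod N) (hsum : ∑ i, ZMod.stdAddChar (d i) = 0) {p q : ι}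
    (hpq : ZMod.stdAddChar (d p) = -ZMod.stdAddChar (d q)) :
    IsTwoThree (h : ZMod N) {p, q} (fun i => (m : ZMod N) * d i)
      (fun i => (2 ^ k : ZMod N) * d i) := by
  have hN0 : N ≠ 0 := NeZero.ne N
  have hinj := ZMod.injective_stdAddChar (N := N)
  have hnorm : ∀ e : ZMod N, ‖ZMod.stdAddChar e‖ = 1 := fun e => AddChar.norm_apply _ _
  have hne : p ≠ q := by
    rintro rfl
    have h0 : ZMod.stdAddChar (d p) = 0 := by linear_combination hpq / 2
    have := hnorm (d p)
    rw [h0, norm_zero] at this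
    exact zero_ne_one this
  have h2h : (h : ZMod N) + h = 0 := by
    have : ((2 * h : ℕ) : ZMod N) = 0 := by rw [← hN, ZMod.natCast_self]
    push_cast at this
    linear_combination this
  have hh : ZMod.stdAddChar (h : ZMod N) = -1 := by
    have h1 : ZMod.stdAddChar (h : ZMod N) ^ 2 = 1 := by
      rw [pow_two, ← AddChar.map_add_eq_mul, h2h, AddChar.map_zero_eq_one]
    refine (sq_eq_one_iff.1 h1).resolve_left fun h2 => ?_
    have h3 : (h : ZMod N) = 0 := hinj (by rw [h2, AddChar.map_zero_eq_one])
    have := Nat.le_of_dvd (by omega) ((ZMod.natCast_eq_zero_iff _ _).1 h3)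
    omega
  have hmh : (m : ZMod N) * h = h := by
    obtain ⟨c, rfl⟩ := hm
    push_cast
    linear_combination (c : ZMod N) * h2h
  have hkh : (2 ^ k : ZMod N) * h = 0 := by
    rcases k with _ | k
    · obtain ⟨c, rfl⟩ := hm
      omega
    · rw [pow_succ]; linear_combination (2 ^ k : ZMod N) * h2h
  have hd : d p = d q + h := hinj (by rw [AddChar.map_add_eq_mul, hh, hpq]; ring)
  have hthree : ∀ x ∉ ({p, q} : Finset ι), ∀ y ∉ ({p, q} : Finset ι), ∀ z ∉ ({p, q} : Finset ι),
      x ≠ y → x ≠ z → y ≠ z → d x + d y = d z + d z ∧ d x ≠ d y := by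
    intro x hx y hy z hz hxy hxz hyz
    simp only [Finset.mem_insert, Finset.mem_singleton, not_or] at hx hy hz
    have n1 : p ∉ ({q, x, y, z} : Finset ι) := by grind
    have n2 : q ∉ ({x, y, z} : Finset ι) := by grind
    have n3 : x ∉ ({y, z} : Finset ι) := by grind
    have n4 : y ∉ ({z} : Finset ι) := by grind
    have huniv : ({p, q, x, y, z} : Finset ι) = Finset.univ := by
      apply Finset.eq_univ_of_card
      rw [Finset.card_insert_of_notMem n1, Finset.card_insert_of_notMem n2,
        Finset.card_insert_of_notMem n3, Finset.card_insert_of_notMem n4, Finset.card_singleton, hι]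
    rw [← huniv, Finset.sum_insert n1, Finset.sum_insert n2, Finset.sum_insert n3,
      Finset.sum_insert n4, Finset.sum_singleton] at hsum
    obtain ⟨h1, h2⟩ := mul_eq_sq_and_ne_of_add_eq_zero (hnorm (d x)) (hnorm (d y)) (hnorm (d z))
      (by linear_combination hsum - hpq)
    refine ⟨hinj ?_, fun h => h2 (by rw [h])⟩
    rw [AddChar.map_add_eq_mul, AddChar.map_add_eq_mul, h1, pow_two]
  have htwo : ∀ x ∉ ({p, q} : Finset ι), ∀ y ∉ ({p, q} : Finset ι),
      x ≠ y → 3 * (d x - d y) = 0 ∧ d x ≠ d y := by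
    intro x hx y hy hxy
    obtain ⟨z, -, hz⟩ := Finset.exists_mem_notMem_of_card_lt_card
      (s := ({x, y, p, q} : Finset ι)) (t := Finset.univ)
      (Finset.card_le_four.trans_lt (by rw [Finset.card_univ, hι]; norm_num))
    have hz' : z ∉ ({p, q} : Finset ι) := by grind
    have hxz : x ≠ z := by grind
    have hyz : y ≠ z := by grind
    obtain ⟨h1, h2⟩ := hthree x hx y hy z hz' hxy hxz hyz
    obtain ⟨h3, -⟩ := hthree x hx z hz' y hy hxz hxy hyz.symm
    exact ⟨by linear_combination h1 + 2 * h3, h2⟩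
  refine ⟨Finset.card_pair hne, ?_, ?_, ?_, ?_, ?_⟩
  · intro x hx y hy hxy
    simp only [Finset.mem_insert, Finset.mem_singleton] at hx hy
    rcases hx with rfl | rfl <;> rcases hy with rfl | rfl
    · exact absurd rfl hxy
    · linear_combination (m : ZMod N) * hd + hmh
    · linear_combination -(m : ZMod N) * hd - hmh - h2h
    · exact absurd rfl hxy
  · intro x hx y hy
    rcases eq_or_ne x y with rfl | hxy
    · rfl
    -- a difference killed by `3` is a multiple of `2 ^ k`
    have h3 := (htwo x hx y hy hxy).1
    have hval : ((3 * (d x - d y).val : ℕ) : ZMod N) = 0 := by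
      push_cast; rw [ZMod.natCast_zmod_val, h3]
    have hdvd : 2 ^ k ∣ (d x - d y).val := by
      have hcop : Nat.Coprime (2 ^ k) 3 := Nat.Coprime.pow_left k (by norm_num)
      refine hcop.dvd_of_dvd_mul_left ?_
      exact (hNm ▸ Dvd.intro _ rfl : 2 ^ k ∣ N).trans ((ZMod.natCast_eq_zero_iff _ _).1 hval)
    have : ((m * (d x - d y).val : ℕ) : ZMod N) = 0 := by
      rw [ZMod.natCast_eq_zero_iff]
      exact (dvd_of_eq (by rw [hNm, mul_comm])).trans (mul_dvd_mul_left m hdvd)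
    push_cast at this
    rw [ZMod.natCast_zmod_val] at this
    linear_combination this
  · intro x hx y hy
    simp only [Finset.mem_insert, Finset.mem_singleton] at hx hy
    rcases hx with rfl | rfl <;> rcases hy with rfl | rfl
    · rfl
    · linear_combination (2 ^ k : ZMod N) * hd + hkh
    · linear_combination -(2 ^ k : ZMod N) * hd - hkh
    · rfl
  · intro x hx y hy hxy heq
    obtain ⟨h3, hne'⟩ := htwo x hx y hy hxy
    obtain ⟨a, b, hab⟩ : IsCoprime (2 ^ k : ℤ) 3 := by
      exact IsCoprime.pow_left (by norm_num)
    have hab' := congrArg (Int.cast : ℤ → ZMod N) hab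
    push_cast at hab'
    refine hne' (sub_eq_zero.1 ?_)
    linear_combination (a : ZMod N) * heq + (b : ZMod N) * h3 - (d x - d y) * hab'
  · intro x hx y hy z hz hxy hxz hyz
    linear_combination (2 ^ k : ZMod N) * (hthree x hx y hy z hz hxy hxz hyz).1

theorem tilesGroup_of_card_eq_five {G : Type*} [AddCommGroup G] [Finite G] {A : Finset G}
    (hcard : A.card = 5) (χ : Fin A.card → AddChar G ℂ)
    (hχ : ∀ i j, i ≠ j → ∑ a ∈ A, (χ j / χ i) a = 0) : TilesGroup A := by
  classical
  have hι : Fintype.card A = 5 := by rw [Fintype.card_coe, hcard]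
  set h := Nat.card G
  have hh0 : h ≠ 0 := Nat.card_pos.ne'
  -- twice the order of `G` is a period, and it is even
  obtain ⟨k, m, hm, hN⟩ := Nat.exists_eq_two_pow_mul_odd (n := 2 * h) (by omega)
  have : NeZero (2 * h) := ⟨by omega⟩
  have hroot : ∀ (ψ : AddChar G ℂ) (a : G), ψ a ^ (2 * h) = 1 := fun ψ a => by
    rw [mul_comm, pow_mul, ← AddChar.map_nsmul_eq_pow, card_nsmul_eq_zero',
      AddChar.map_zero_eq_one, one_pow]
  by_cases hcancel : ∃ i j, i ≠ j ∧ ∀ a b : A, (χ j / χ i) a ≠ -(χ j / χ i) b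
  · obtain ⟨i, j, hij, hne⟩ := hcancel
    obtain ⟨h5, hinj⟩ := pow_five_eq_of_sum_eq_zero hι hm k (z := fun a : A => (χ j / χ i) a)
      (fun a => by rw [← hN]; exact hroot _ _)
      (by rw [← hχ i j hij]; exact Finset.sum_coe_sort A _) hne
    refine tilesGroup_of_injOn_of_pow_eq (Finset.card_pos.1 (by omega)) (χ j / χ i) ?_ ?_
    · intro a ha b hb hab
      exact congrArg Subtype.val (@hinj ⟨a, ha⟩ ⟨b, hb⟩ hab)
    · intro a ha b hb
      rw [hcard]
      exact h5 ⟨a, ha⟩ ⟨b, hb⟩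
  exfalso
  push Not at hcancel
  choose e he using fun (i : Fin A.card) (a : A) => ZMod.exists_stdAddChar_eq (hroot (χ i) a)
  have hdiff : ∀ i j (a : A), ZMod.stdAddChar (e j a - e i a) = (χ j / χ i) a := fun i j a => by
    rw [AddChar.map_sub_eq_div, he, he, AddChar.div_apply']
  have hpair : ∀ i j, i ≠ j → ∃ P : Finset A, IsTwoThree ((h : ℕ) : ZMod (2 * h)) P
      (fun a => (m : ZMod (2 * h)) * (e j a - e i a))
      (fun a => (2 ^ k : ZMod (2 * h)) * (e j a - e i a)) := by
    intro i j hij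
    obtain ⟨p, q, hpq⟩ := hcancel i j hij
    refine ⟨{p, q}, isTwoThree_of_sum_eq_zero hι rfl hN hm (fun a => e j a - e i a) ?_ ?_⟩
    · simp only [hdiff]
      rw [← hχ i j hij]; exact Finset.sum_coe_sort A (χ j / χ i)
    · rw [hdiff, hdiff, hpq]
  have hodd : ∀ i j (x y : A), 4 * ((2 ^ k : ZMod (2 * h)) * (e j x - e i x)) =
      4 * ((2 ^ k : ZMod (2 * h)) * (e j y - e i y)) →
      (2 ^ k : ZMod (2 * h)) * (e j x - e i x) = (2 ^ k : ZMod (2 * h)) * (e j y - e i y) := by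
    intro i j x y hxy
    obtain ⟨a, b, hab⟩ : IsCoprime (4 : ℤ) (m : ℤ) := by
      have : Nat.Coprime (2 ^ 2) m := Nat.Coprime.pow_left 2 (Nat.coprime_two_left.2 hm)
      exact_mod_cast Nat.isCoprime_iff_coprime.2 this
    have hab' := congrArg (Int.cast : ℤ → ZMod (2 * h)) hab
    have h0 : ((2 ^ k * m : ℕ) : ZMod (2 * h)) = 0 := by
      rw [← hN, ZMod.natCast_self]
    push_cast at hab' h0
    linear_combination (a : ZMod (2 * h)) * hxy
      + ((b : ZMod (2 * h)) * (e j x - e i x) - (b : ZMod (2 * h)) * (e j y - e i y)) * h0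
      - ((2 ^ k : ZMod (2 * h)) * (e j x - e i x) - (2 ^ k : ZMod (2 * h)) * (e j y - e i y)) * hab'
  have hs : ((h : ℕ) : ZMod (2 * h)) ≠ 0 := fun h0 => by
    have := Nat.le_of_dvd (by omega) ((ZMod.natCast_eq_zero_iff _ _).1 h0)
    omega
  have h2s : ((h : ℕ) : ZMod (2 * h)) + (h : ℕ) = 0 := by
    have : ((2 * h : ℕ) : ZMod (2 * h)) = 0 := ZMod.natCast_self _
    push_cast at this
    linear_combination this
  let r : Fin 4 → Fin A.card := fun i => ⟨i, by omega⟩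
  have hr : ∀ {i j}, i ≠ j → r i ≠ r j := fun hij hr =>
    hij (Fin.ext (Fin.mk.inj_iff.1 hr))
  obtain ⟨P, hP⟩ := hpair (r 0) (r 1) (hr (by decide))
  obtain ⟨Q, hQ⟩ := hpair (r 0) (r 2) (hr (by decide))
  obtain ⟨R, hR⟩ := hpair (r 0) (r 3) (hr (by decide))
  obtain ⟨S, hS⟩ := hpair (r 1) (r 2) (hr (by decide))
  obtain ⟨T, hT⟩ := hpair (r 1) (r 3) (hr (by decide))
  obtain ⟨U, hU⟩ := hpair (r 2) (r 3) (hr (by decide))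
  refine IsTwoThree.false_of_four_rows hι hs h2s ZMod.eq_or_add_eq_zero_of_three_mul
    (hodd _ _) (hodd _ _) (hodd _ _) hP hQ hR (S := S) (T := T) (U := U) ?_ ?_ ?_
  · convert hS using 1 <;> ext a <;> simp only [Pi.sub_apply] <;> ring
  · convert hT using 1 <;> ext a <;> simp only [Pi.sub_apply] <;> ring
  · convert hU using 1 <;> ext a <;> simp only [Pi.sub_apply] <;> ring

/-! ### Sets of two and three elements -/

theorem tilesGroup_of_card_eq_two {G : Type*} [AddCommGroup G] [Finite G] {A : Finset G}
    (hcard : A.card = 2) (χ : Fin A.card → AddChar G ℂ)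
    (hχ : ∀ i j, i ≠ j → ∑ a ∈ A, (χ j / χ i) a = 0) : TilesGroup A := by
  classical
  have hsum := hχ ⟨0, by omega⟩ ⟨1, by omega⟩ (by simp)
  set ψ := χ ⟨1, by omega⟩ / χ ⟨0, by omega⟩
  obtain ⟨a, b, hab, hA⟩ := Finset.card_eq_two.1 hcard
  rw [hA, Finset.sum_pair hab] at hsum
  have hb : ψ b = -ψ a := by linear_combination hsum
  have ha0 : ψ a ≠ 0 := (ψ.val_isUnit a).ne_zero
  refine tilesGroup_of_injOn_of_pow_eq ⟨a, by simp [hA]⟩ ψ ?_ ?_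
  · rw [hA]
    intro x hx y hy hxy
    simp only [Finset.coe_insert, Finset.coe_singleton, Set.mem_insert_iff,
      Set.mem_singleton_iff] at hx hy
    rcases hx with rfl | rfl <;> rcases hy with rfl | rfl
    · rfl
    · exact absurd (by linear_combination (hxy + hb) / 2) ha0
    · exact absurd (by linear_combination (hb - hxy) / 2) ha0
    · rfl
  · rw [hcard]
    have : ∀ x ∈ A, ψ x ^ 2 = ψ a ^ 2 := by
      rw [hA]
      intro x hx
      simp only [Finset.mem_insert, Finset.mem_singleton] at hx
      rcases hx with rfl | rfl
      · rfl
      · rw [hb, neg_sq]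
    intro x hx y hy
    rw [this x hx, this y hy]

theorem tilesGroup_of_card_eq_three {G : Type*} [AddCommGroup G] [Finite G] {A : Finset G}
    (hcard : A.card = 3) (χ : Fin A.card → AddChar G ℂ)
    (hχ : ∀ i j, i ≠ j → ∑ a ∈ A, (χ j / χ i) a = 0) : TilesGroup A := by
  classical
  have hsum := hχ ⟨0, by omega⟩ ⟨1, by omega⟩ (by simp)
  set ψ := χ ⟨1, by omega⟩ / χ ⟨0, by omega⟩
  obtain ⟨a, b, c, hab, hac, hbc, hA⟩ := Finset.card_eq_three.1 hcard
  rw [hA, Finset.sum_insert (by simp [hab, hac]), Finset.sum_pair hbc] at hsum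
  have hn : ∀ x, ‖ψ x‖ = 1 := fun x => AddChar.norm_apply _ _
  obtain ⟨e1, n1⟩ := mul_eq_sq_and_ne_of_add_eq_zero (hn a) (hn b) (hn c)
    (by linear_combination hsum)
  obtain ⟨e2, n2⟩ := mul_eq_sq_and_ne_of_add_eq_zero (hn a) (hn c) (hn b)
    (by linear_combination hsum)
  obtain ⟨e3, n3⟩ := mul_eq_sq_and_ne_of_add_eq_zero (hn b) (hn c) (hn a)
    (by linear_combination hsum)
  refine tilesGroup_of_injOn_of_pow_eq ⟨a, by simp [hA]⟩ ψ ?_ ?_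
  · rw [hA]
    intro x hx y hy hxy
    simp only [Finset.coe_insert, Finset.coe_singleton, Set.mem_insert_iff,
      Set.mem_singleton_iff] at hx hy
    rcases hx with rfl | rfl | rfl <;> rcases hy with rfl | rfl | rfl <;>
      first | rfl | exact absurd hxy ‹_› | exact absurd hxy.symm ‹_›
  · rw [hcard]
    have : ∀ x ∈ A, ψ x ^ 3 = ψ a * ψ b * ψ c := by
      rw [hA]
      intro x hx
      simp only [Finset.mem_insert, Finset.mem_singleton] at hx
      rcases hx with rfl | rfl | rfl
      · linear_combination -ψ x * e3
      · linear_combination -ψ x * e2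
      · linear_combination -ψ x * e1
    intro x hx y hy
    rw [this x hx, this y hy]

/-! ### Sets of four elements -/

theorem eq_neg_pairs_of_add_eq_zero {x y z w : ℂ} (hx : ‖x‖ = 1) (hy : ‖y‖ = 1) (hz : ‖z‖ = 1)
    (hw : ‖w‖ = 1) (h : x + y + z + w = 0) :
    (x = -y ∧ z = -w) ∨ (x = -z ∧ y = -w) ∨ (x = -w ∧ y = -z) := by
  have hx0 : x ≠ 0 := norm_ne_zero_iff.1 (by simp [hx])
  have hy0 : y ≠ 0 := norm_ne_zero_iff.1 (by simp [hy])
  have hz0 : z ≠ 0 := norm_ne_zero_iff.1 (by simp [hz])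
  have hw0 : w ≠ 0 := norm_ne_zero_iff.1 (by simp [hw])
  have h' : x⁻¹ + y⁻¹ + z⁻¹ + w⁻¹ = 0 := by
    rw [Complex.inv_eq_conj hx, Complex.inv_eq_conj hy, Complex.inv_eq_conj hz,
      Complex.inv_eq_conj hw, ← map_add, ← map_add, ← map_add, h, map_zero]
  field_simp at h'
  have key : (x + y) * ((x + z) * (x + w)) = 0 := by linear_combination h' + x ^ 2 * h
  rcases mul_eq_zero.1 key with h1 | h1
  · exact Or.inl ⟨by linear_combination h1, by linear_combination h - h1⟩
  rcases mul_eq_zero.1 h1 with h1 | h1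
  · exact Or.inr (Or.inl ⟨by linear_combination h1, by linear_combination h - h1⟩)
  · exact Or.inr (Or.inr ⟨by linear_combination h1, by linear_combination h - h1⟩)

/-- Orthogonality of `φ` and `ψ` factors as `(φ c - φ a) * (ψ a - ψ b) = 0`, and either factor gives
the pattern of `tilesGroup_of_eq_four`. -/
theorem tilesGroup_of_neg_pairs {G : Type*} [AddCommGroup G] [Finite G] {A : Finset G}
    {a b c d : G} (hA : ∀ x, x ∈ A ↔ x = a ∨ x = b ∨ x = c ∨ x = d) (φ ψ : AddChar G ℂ)
    (hab : φ a = -φ b) (hcd : φ c = -φ d) (hac : ψ a = -ψ c) (hbd : ψ b = -ψ d)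
    (h : (ψ / φ) a + (ψ / φ) b + (ψ / φ) c + (ψ / φ) d = 0) : TilesGroup A := by
  have hφ : ∀ x, φ x ≠ 0 := fun x => (φ.val_isUnit x).ne_zero
  have hψ : ∀ x, ψ x ≠ 0 := fun x => (ψ.val_isUnit x).ne_zero
  have hb : φ b = -φ a := by rw [hab, neg_neg]
  have hd : φ d = -φ c := by rw [hcd, neg_neg]
  have hc : ψ c = -ψ a := by rw [hac, neg_neg]
  have hd' : ψ d = -ψ b := by rw [hbd, neg_neg]
  simp only [AddChar.div_apply', hb, hd, hc, hd'] at h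
  have h0 := hφ a
  have h1 := hφ c
  have key : (φ c - φ a) * (ψ a - ψ b) = 0 := by
    field_simp at h
    linear_combination h
  rcases mul_eq_zero.1 key with h2 | h2
  · exact tilesGroup_of_eq_four (a := a) (b := c) (c := b) (d := d) (fun x => by rw [hA]; tauto)
      φ ψ (by linear_combination -h2) hab (by rw [hb, hd]; linear_combination h2) hac hbd
  · exact tilesGroup_of_eq_four hA ψ φ (by linear_combination h2) hac
      (by rw [hc, hd']; linear_combination -h2) hab hcd

theorem tilesGroup_of_neg_of_neg {G : Type*} [AddCommGroup G] [Finite G] {A : Finset G}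
    (hcard : A.card = 4) {φ ψ : AddChar G ℂ} {a p q : G} (ha : a ∈ A) (hp : p ∈ A) (hq : q ∈ A)
    (hap : a ≠ p) (haq : a ≠ q) (hpq : p ≠ q) (hφ : φ a = -φ p) (hψ : ψ a = -ψ q)
    (hφs : ∑ x ∈ A, φ x = 0) (hψs : ∑ x ∈ A, ψ x = 0) (hs : ∑ x ∈ A, (ψ / φ) x = 0) :
    TilesGroup A := by
  classical
  have h3 : ({a, p, q} : Finset G).card = 3 := Finset.card_eq_three.2 ⟨a, p, q, hap, haq, hpq, rfl⟩
  have hsub : ({a, p, q} : Finset G) ⊆ A := by grind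
  obtain ⟨o, ho⟩ := Finset.card_eq_one.1
    (show (A \ {a, p, q}).card = 1 by rw [Finset.card_sdiff_of_subset hsub, hcard, h3])
  have hmem : ∀ x, x ∈ A \ {a, p, q} ↔ x = o := fun x => by rw [ho, Finset.mem_singleton]
  have hsum : ∀ f : G → ℂ, ∑ x ∈ A, f x = f a + f p + f q + f o := fun f => by
    rw [← Finset.sum_sdiff hsub, ho, Finset.sum_singleton,
      Finset.sum_insert (by simp [hap, haq]), Finset.sum_pair hpq]
    ring
  rw [hsum] at hφs hψs hs
  refine tilesGroup_of_neg_pairs (a := a) (b := p) (c := q) (d := o) (fun x => ?_) φ ψ hφ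
    (by linear_combination hφs - hφ) hψ (by linear_combination hψs - hψ) hs
  have := hmem x
  simp only [Finset.mem_sdiff, Finset.mem_insert, Finset.mem_singleton] at this
  constructor
  · intro hx
    by_contra h
    exact h (by tauto)
  · rintro (rfl | rfl | rfl | rfl)
    · exact ha
    · exact hp
    · exact hq
    · exact (this.2 rfl).1

theorem exists_neg_of_sum_eq_zero {G : Type*} [AddCommGroup G] [Finite G] {A : Finset G}
    (hcard : A.card = 4) {ψ : AddChar G ℂ} {a : G} (ha : a ∈ A) (hs : ∑ x ∈ A, ψ x = 0) :
    ∃ p ∈ A, a ≠ p ∧ ψ a = -ψ p := by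
  classical
  obtain ⟨b, c, d, hbc, hbd, hcd, hB⟩ := Finset.card_eq_three.1
    (show (A.erase a).card = 3 by rw [Finset.card_erase_of_mem ha, hcard])
  have hmem : ∀ x, x = b ∨ x = c ∨ x = d → x ∈ A ∧ a ≠ x := fun x hx => by
    have : x ∈ A.erase a := by rw [hB]; simpa using hx
    exact ⟨Finset.mem_of_mem_erase this, (Finset.ne_of_mem_erase this).symm⟩
  rw [← Finset.add_sum_erase A _ ha, hB, Finset.sum_insert (by simp [hbc, hbd]),
    Finset.sum_pair hcd] at hs
  have hn : ∀ x, ‖ψ x‖ = 1 := fun x => AddChar.norm_apply _ _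
  rcases eq_neg_pairs_of_add_eq_zero (hn a) (hn b) (hn c) (hn d) (by linear_combination hs) with
    ⟨h, -⟩ | ⟨h, -⟩ | ⟨h, -⟩
  · exact ⟨b, (hmem b (by simp)).1, (hmem b (by simp)).2, h⟩
  · exact ⟨c, (hmem c (by simp)).1, (hmem c (by simp)).2, h⟩
  · exact ⟨d, (hmem d (by simp)).1, (hmem d (by simp)).2, h⟩

/-- If two orthogonal rows cancel in the same pair `{a, p}`, their ratios at `a` and at a third point
`o` are opposite. Hence three pairwise orthogonal rows cannot all cancel in `{a, p}`. -/
theorem exists_forall_mul_eq_neg_mul {G : Type*} [AddCommGroup G] {A : Finset G}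
    (hcard : A.card = 4) {a p : G} (ha : a ∈ A) (hp : p ∈ A) (hap : a ≠ p) :
    ∃ o, ∀ φ ψ : AddChar G ℂ, φ a = -φ p → ψ a = -ψ p → ∑ x ∈ A, φ x = 0 → ∑ x ∈ A, ψ x = 0 →
      ∑ x ∈ A, (ψ / φ) x = 0 → ψ o * φ a = -(ψ a * φ o) := by
  classical
  have hsub : ({a, p} : Finset G) ⊆ A := by grind
  obtain ⟨o, o', hoo, ho⟩ := Finset.card_eq_two.1
    (show (A \ {a, p}).card = 2 by
      rw [Finset.card_sdiff_of_subset hsub, hcard, Finset.card_pair hap])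
  have hsum : ∀ f : G → ℂ, ∑ x ∈ A, f x = f a + f p + f o + f o' := fun f => by
    rw [← Finset.sum_sdiff hsub, ho, Finset.sum_pair hoo, Finset.sum_pair hap]
    ring
  refine ⟨o, fun φ ψ h1 h2 h3 h4 h5 => ?_⟩
  rw [hsum] at h3 h4 h5
  have hφ : ∀ x, φ x ≠ 0 := fun x => (φ.val_isUnit x).ne_zero
  have e1 : φ p = -φ a := by linear_combination h1
  have e2 : ψ p = -ψ a := by linear_combination h2
  have e3 : φ o' = -φ o := by linear_combination h3 - h1
  have e4 : ψ o' = -ψ o := by linear_combination h4 - h2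
  have := hφ a
  have := hφ o
  simp only [AddChar.div_apply', e1, e2, e3, e4] at h5
  field_simp at h5
  linear_combination h5 / 2

theorem tilesGroup_of_card_eq_four {G : Type*} [AddCommGroup G] [Finite G] {A : Finset G}
    (hcard : A.card = 4) (χ : Fin A.card → AddChar G ℂ)
    (hχ : ∀ i j, i ≠ j → ∑ a ∈ A, (χ j / χ i) a = 0) : TilesGroup A := by
  obtain ⟨a, ha⟩ : A.Nonempty := Finset.card_pos.1 (by omega)
  let r : Fin 4 → Fin A.card := fun i => ⟨i, by omega⟩
  have hrow : ∀ {i j}, i ≠ j → ∑ x ∈ A, (χ (r j) / χ (r i)) x = 0 := fun hij =>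
    hχ _ _ fun hr => hij (Fin.ext (Fin.mk.inj_iff.1 hr))
  have hquot : ∀ {i j}, i ≠ j →
      ∑ x ∈ A, ((χ (r j) / χ (r 0)) / (χ (r i) / χ (r 0))) x = 0 := fun hij => by
    rw [div_div_div_cancel_right]; exact hrow hij
  have h1 := hrow (show (0 : Fin 4) ≠ 1 by decide)
  have h2 := hrow (show (0 : Fin 4) ≠ 2 by decide)
  have h3 := hrow (show (0 : Fin 4) ≠ 3 by decide)
  have h12 := hquot (show (1 : Fin 4) ≠ 2 by decide)
  have h13 := hquot (show (1 : Fin 4) ≠ 3 by decide)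
  have h23 := hquot (show (2 : Fin 4) ≠ 3 by decide)
  generalize χ (r 1) / χ (r 0) = u at *
  generalize χ (r 2) / χ (r 0) = v at *
  generalize χ (r 3) / χ (r 0) = w at *
  obtain ⟨p, hp, hap, hup⟩ := exists_neg_of_sum_eq_zero hcard ha h1
  obtain ⟨q, hq, haq, hvq⟩ := exists_neg_of_sum_eq_zero hcard ha h2
  obtain ⟨t, ht, hat, hwt⟩ := exists_neg_of_sum_eq_zero hcard ha h3
  rcases ne_or_eq p q with hpq | rfl
  · exact tilesGroup_of_neg_of_neg hcard ha hp hq hap haq hpq hup hvq h1 h2 h12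
  rcases ne_or_eq p t with hpt | rfl
  · exact tilesGroup_of_neg_of_neg hcard ha hp ht hap hat hpt hup hwt h1 h3 h13
  exfalso
  obtain ⟨o, ho⟩ := exists_forall_mul_eq_neg_mul hcard ha hp hap
  have e12 := ho u v hup hvq h1 h2 h12
  have e13 := ho u w hup hwt h1 h3 h13
  have e23 := ho v w hvq hwt h2 h3 h23
  have hu0 : u a ≠ 0 := (u.val_isUnit a).ne_zero
  have hw0 : w a ≠ 0 := (w.val_isUnit a).ne_zero
  have hv0 : v o ≠ 0 := (v.val_isUnit o).ne_zero
  have : u a * (w a * v o) = 0 := by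
    linear_combination (w a * e12 + u a * e23 - v a * e13) / 2
  simp [hu0, hv0, hw0] at this

/-! ### Spectral sets with at most five elements -/

theorem theorem2p1 {G : Type*} [AddCommGroup G] [Finite G] (A : Finset G) (hne : A.Nonempty)
    (hcard : A.card ≤ 5) (hA : IsSpectral A) : TilesGroup A := by
  obtain ⟨χ, hχ⟩ := hA.exists_characters
  have hpos := hne.card_pos
  rcases (by omega : A.card = 1 ∨ A.card = 2 ∨ A.card = 3 ∨ A.card = 4 ∨ A.card = 5) with
    h | h | h | h | h
  · obtain ⟨a, rfl⟩ := Finset.card_eq_one.1 h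
    exact tilesGroup_of_injOn_of_pow_eq hne 0 (by simp) (by simp)
  · exact tilesGroup_of_card_eq_two h χ hχ
  · exact tilesGroup_of_card_eq_three h χ hχ
  · exact tilesGroup_of_card_eq_four h χ hχ
  · exact tilesGroup_of_card_eq_five h χ hχ
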